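/- Let $3^\omega=\{0,1,2\}^{\mathbb N}$ with its product Borel structure, and let $E_0$ be the relation of eventual equality on it: $x\,E_0\,y$ iff $x_n=y_n$ for all but finitely many $n$. A subset of $3^\omega/E_0$ (of $(3^\omega/E_0)^2$) is called Borel if its preimage in $3^\omega$ (in $3^\omega\times 3^\omega$) is Borel. A Borel automorphism of $(3^\omega,E_0)$ is a bijection $f$ of $3^\omega/E_0$ such that the graphs of $f$ and $f^{-1}$ are Borel, and a Borel involution is a Borel automorphism $f$ with $f\circ f=\mathrm{id}$. Let $\mu$ be the image on $3^\omega/E_0$ of the $\omega$-th power of the uniform measure $(\tfrac13,\tfrac13,\tfrac13)$ on $\{0,1,2\}$. Identify $\mathbb Z/3\mathbb Z$ with the subgroup of the symmetric group on $\{0,1,2\}$ generated by an element of order $3$, let it act componentwise on $3^\omega$, and let $E_0(\mathbb Z/3\mathbb Z)$ be the equivalence relation on $3^\omega$ generated by $E_0$ and the orbit equivalence relation of this action. Then $E_0$ and $E_0(\mathbb Z/3\mathbb Z)$ are countable Borel equivalence relations; the induced action of $\mathbb Z/3\mathbb Z$ on $3^\omega/E_0$ is free and by Borel automorphisms; and the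 quotient relation $F=E_0(\mathbb Z/3\mathbb Z)/E_0$ on $3^\omega/E_0$ is Borel, is the orbit equivalence relation of the induced action, and has all its classes of cardinality exactly $3$. Moreover: 1. every Borel involution $f$ of $(3^\omega,E_0)$ whose graph is contained in $F$ satisfies $f(q)=q$ for $\mu$-almost every $q\in 3^\omega/E_0$; 2. there is no countable set $S$ of Borel involutions of $(3^\omega,E_0)$ such that $F$ is the smallest equivalence relation on $3^\omega/E_0$ containing the graphs of all members of $S$. -/

import Mathlib

open MeasureTheory

namespace QuotientBorel

variable {X Y : Type*} [MeasurableSpace X] [MeasurableSpace Y]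

/-- A countable Borel equivalence relation `E` on a measurable space `X`. When `X` is standard
Borel, the pair `(X, E)` is a quotient Borel space, with underlying set `Quotient E`. -/
def IsCountableBorel (E : Setoid X) : Prop :=
  MeasurableSet {p : X × X | E p.1 p.2} ∧ ∀ x, {y | E x y}.Countable

/-- A binary relation between quotient Borel spaces is Borel if it is a Borel subset of
`(X × Y, E × F)`, that is, if its preimage in `X × Y` is Borel (this is weaker than being
measurable for the product of the two quotient σ-algebras). -/
def IsBorelRel {E : Setoid X} {F : Setoid Y} (R : Quotient E → Quotient F → Prop) : Prop :=
  MeasurableSet {p : X × Y | R (Quotient.mk E p.1) (Quotient.mk F p.2)}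

/-- A function between quotient Borel spaces is Borel if its graph is a Borel relation. -/
def IsBorelFun {E : Setoid X} {F : Setoid Y} (f : Quotient E → Quotient F) : Prop :=
  IsBorelRel fun a b => f a = b

/-- A Borel automorphism of the quotient Borel space `(X, E)`. -/
def IsBorelAut {E : Setoid X} (f : Equiv.Perm (Quotient E)) : Prop :=
  IsBorelFun f ∧ IsBorelFun f.symm

/-- A Borel involution of `(X, E)`: a Borel automorphism `f` with `f ∘ f = id`. -/
def IsBorelInvolution {E : Setoid X} (f : Equiv.Perm (Quotient E)) : Prop :=
  IsBorelAut f ∧ Function.Involutive f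

/-- The graph of `f` is contained in the equivalence relation `F`. -/
def GraphIn {Q : Type*} (f : Q → Q) (F : Setoid Q) : Prop :=
  ∀ q, F q (f q)

/-- The smallest equivalence relation containing the graphs of all the permutations in `S`. -/
def generated {Q : Type*} (S : Set (Equiv.Perm Q)) : Setoid Q :=
  sInf {F | ∀ f ∈ S, GraphIn f F}

/-- The quotient relation `F / E` on `X / E`, for equivalence relations `E ≤ F` on `X`. -/
def quotientRel {Z : Type*} (E F : Setoid Z) (h : E ≤ F) : Setoid (Quotient E) :=
  Setoid.ker (Quotient.lift (fun x => Quotient.mk F x) fun _ _ hab => Quotient.sound (h hab))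

/-- Eventual equality of infinite ternary sequences. -/
def E₀ : Setoid (ℕ → Fin 3) where
  r x y := ∃ n₀, ∀ n ≥ n₀, x n = y n
  iseqv :=
    { refl := fun _ => ⟨0, fun _ _ => rfl⟩
      symm := fun ⟨m, h⟩ => ⟨m, fun n hn => (h n hn).symm⟩
      trans := fun ⟨m, h⟩ ⟨k, h'⟩ =>
        ⟨max m k, fun n hn => (h n (le_trans (le_max_left m k) hn)).trans
          (h' n (le_trans (le_max_right m k) hn))⟩ }

/-- The relation `E₀(Δ)` generated by `E₀` and by the orbit equivalence relation of the
componentwise action of `Δ ≤ Sym(3)` on ternary sequences. -/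
def E₀Of (Δ : Subgroup (Equiv.Perm (Fin 3))) : Setoid (ℕ → Fin 3) :=
  E₀ ⊔ MulAction.orbitRel Δ (ℕ → Fin 3)

/-- The quotient relation `E₀(Δ) / E₀` on the quotient Borel space of ternary sequences mod `E₀`. -/
def E₀OfMod (Δ : Subgroup (Equiv.Perm (Fin 3))) : Setoid (Quotient E₀) :=
  quotientRel E₀ (E₀Of Δ) le_sup_left

/-- The action of `Sym(3)` on ternary sequences mod `E₀` induced by the componentwise action. -/
instance : MulAction (Equiv.Perm (Fin 3)) (Quotient E₀) where
  smul σ := Quotient.map (fun x => σ • x) fun _ _ ⟨m, h⟩ => ⟨m, fun n hn => congrArg σ (h n hn)⟩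
  one_smul q := by
    induction q using Quotient.inductionOn with
    | h x => exact congrArg (Quotient.mk E₀) (one_smul _ x)
  mul_smul σ τ q := by
    induction q using Quotient.inductionOn with
    | h x => exact congrArg (Quotient.mk E₀) (mul_smul σ τ x)

/-- The product of the uniform measures on ternary sequences. -/
noncomputable def haarTernary : Measure (ℕ → Fin 3) :=
  Measure.infinitePi fun _ : ℕ => (PMF.uniformOfFintype (Fin 3)).toMeasure

/-- Its image on the quotient by `E₀`, which carries the quotient σ-algebra. -/
noncomputable def haarMod : Measure (Quotient E₀) :=
  haarTernary.map (Quotient.mk E₀)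

end QuotientBorel

namespace QuotientBorel

open ProbabilityTheory Filter

/-! If the graph of a Borel `f` lies in the orbit relation of the order-3 group, the Borel sets
where `f q = g • q`, for `g` in the group, cover the space and are `E₀`-invariant. By the zero-one
law (`haarTernary_eq_zero_or_one`) one of them is conull. As `g` preserves the measure, some `x` has
both `x` and `g • x` in that set, so an involutive `f` gives `g * g • q = q`. Freeness forces `g * g
= 1`, and `g ^ 3 = 1` then gives `g = 1`: this is `ae_eq_self_of_involutive`. Countably many such
involutions share a fixed point `q`, whose generated class is `{q}`, whereas orbits have three
points. -/

lemma measurable_perm_smul (σ : Equiv.Perm (Fin 3)) :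
    Measurable fun x : ℕ → Fin 3 => σ • x :=
  measurable_pi_lambda _ fun n => (measurable_of_finite σ).comp (measurable_pi_apply n)

lemma measurableSet_E₀ : MeasurableSet {p : (ℕ → Fin 3) × (ℕ → Fin 3) | E₀ p.1 p.2} := by
  have : {p : (ℕ → Fin 3) × (ℕ → Fin 3) | E₀ p.1 p.2} =
      ⋃ n₀ : ℕ, ⋂ n : ℕ, ⋂ _ : n ≥ n₀, {p | p.1 n = p.2 n} := by
    ext p
    simp only [Set.mem_iUnion, Set.mem_iInter]
    rfl
  rw [this]
  refine .iUnion fun n₀ => .iInter fun n => .iInter fun _ => ?_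
  exact measurableSet_eq_fun (by fun_prop) (by fun_prop)

lemma countable_E₀_class (x : ℕ → Fin 3) : {y | E₀ x y}.Countable := by
  have : {y | E₀ x y} ⊆ ⋃ n₀ : ℕ, Set.range fun (s : Fin n₀ → Fin 3) (n : ℕ) =>
      if h : n < n₀ then s ⟨n, h⟩ else x n := by
    rintro y ⟨n₀, h⟩
    refine Set.mem_iUnion.2 ⟨n₀, fun i => y i, ?_⟩
    funext n
    by_cases hn : n < n₀
    · simp [hn]
    · simpa [hn] using h n (not_lt.1 hn)
  exact (Set.countable_iUnion fun _ => Set.countable_range _).mono this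

lemma E₀Of_iff (Δ : Subgroup (Equiv.Perm (Fin 3))) (x y : ℕ → Fin 3) :
    E₀Of Δ x y ↔ ∃ g : Δ, E₀ x ((g : Equiv.Perm (Fin 3)) • y) := by
  constructor
  · intro h
    -- Since `Δ` acts on `E₀`-classes, this pullback is an equivalence relation containing both
    -- generators, so chains in the join collapse to one step.
    have key : E₀Of Δ ≤ (MulAction.orbitRel Δ (Quotient E₀)).comap (Quotient.mk E₀) := by
      refine sup_le (fun a b hab => ?_) ?_
      · exact ⟨1, (one_smul Δ (Quotient.mk E₀ b)).trans (Quotient.sound (Setoid.symm' _ hab))⟩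
      · rintro a b ⟨g, rfl⟩
        exact ⟨g, rfl⟩
    obtain ⟨g, hg⟩ := key h
    exact ⟨g, Quotient.exact hg.symm⟩
  · rintro ⟨g, hg⟩
    refine Setoid.trans' _ ((le_sup_left : E₀ ≤ E₀Of Δ) hg) ?_
    exact (le_sup_right : MulAction.orbitRel Δ (ℕ → Fin 3) ≤ E₀Of Δ) ⟨g, rfl⟩

lemma E₀OfMod_mk (Δ : Subgroup (Equiv.Perm (Fin 3))) (x y : ℕ → Fin 3) :
    E₀OfMod Δ (Quotient.mk E₀ x) (Quotient.mk E₀ y) ↔ E₀Of Δ x y :=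
  Quotient.eq (r := E₀Of Δ)

lemma measurableSet_E₀Of (Δ : Subgroup (Equiv.Perm (Fin 3))) :
    MeasurableSet {p : (ℕ → Fin 3) × (ℕ → Fin 3) | E₀Of Δ p.1 p.2} := by
  simp only [E₀Of_iff, Set.ofPred_exists]
  refine .iUnion fun g => ?_
  exact measurableSet_E₀.preimage
    (measurable_fst.prodMk ((measurable_perm_smul g).comp measurable_snd))

lemma countable_E₀Of_class (Δ : Subgroup (Equiv.Perm (Fin 3))) (x : ℕ → Fin 3) :
    {y | E₀Of Δ x y}.Countable := by
  simp only [E₀Of_iff, Set.ofPred_exists]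
  exact Set.countable_iUnion fun g =>
    (countable_E₀_class x).preimage (MulAction.injective (g : Equiv.Perm (Fin 3)))

lemma E₀OfMod_eq_orbitRel (Δ : Subgroup (Equiv.Perm (Fin 3))) :
    E₀OfMod Δ = MulAction.orbitRel Δ (Quotient E₀) := by
  ext p q
  induction p using Quotient.inductionOn with | h x => ?_
  induction q using Quotient.inductionOn with | h y => ?_
  rw [E₀OfMod_mk, E₀Of_iff]
  exact exists_congr fun g => ⟨fun h => (Quotient.sound h).symm, fun h => Quotient.exact h.symm⟩

lemma isBorelFun_smul (σ : Equiv.Perm (Fin 3)) :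
    IsBorelFun fun q : Quotient E₀ => σ • q := by
  have : {p : (ℕ → Fin 3) × (ℕ → Fin 3) | σ • Quotient.mk E₀ p.1 = Quotient.mk E₀ p.2} =
      (fun p : (ℕ → Fin 3) × (ℕ → Fin 3) => (σ • p.1, p.2)) ⁻¹' {p | E₀ p.1 p.2} := by
    ext p
    exact Quotient.eq (r := E₀)
  unfold IsBorelFun IsBorelRel
  rw [this]
  exact measurableSet_E₀.preimage
    (((measurable_perm_smul σ).comp measurable_fst).prodMk measurable_snd)

/-- The source of freeness: a 3-cycle fixes no letter, while `E₀ (g • x) x` makes `g` fix some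
letter `x n`. -/
lemma eq_one_of_pow_three_of_fixed :
    ∀ (σ : Equiv.Perm (Fin 3)) (i : Fin 3), σ ^ 3 = 1 → σ i = i → σ = 1 := by
  decide

lemma pow_three_of_mem_zpowers {G : Type*} [Group G] {ρ σ : G} (hρ : orderOf ρ = 3)
    (hσ : σ ∈ Subgroup.zpowers ρ) : σ ^ 3 = 1 :=
  orderOf_dvd_iff_pow_eq_one.1 (hρ ▸ orderOf_dvd_of_mem_zpowers hσ)

lemma eq_one_of_smul_eq {ρ : Equiv.Perm (Fin 3)} (hρ : orderOf ρ = 3)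
    (g : Subgroup.zpowers ρ) (q : Quotient E₀) (h : g • q = q) : g = 1 := by
  induction q using Quotient.inductionOn with | h x => ?_
  obtain ⟨n, hn⟩ : E₀ ((g : Equiv.Perm (Fin 3)) • x) x := Quotient.exact h
  exact Subtype.ext (eq_one_of_pow_three_of_fixed _ (x n) (pow_three_of_mem_zpowers hρ g.2)
    (hn n le_rfl))

lemma encard_orbit_eq_three {ρ : Equiv.Perm (Fin 3)} (hρ : orderOf ρ = 3) (q : Quotient E₀) :
    {r | E₀OfMod (Subgroup.zpowers ρ) q r}.encard = 3 := by
  have : {r | E₀OfMod (Subgroup.zpowers ρ) q r} =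
      Set.range fun g : Subgroup.zpowers ρ => g • q := by
    ext r
    rw [E₀OfMod_eq_orbitRel]
    exact Setoid.comm' (MulAction.orbitRel (Subgroup.zpowers ρ) (Quotient E₀))
  have hinj : Function.Injective fun g : Subgroup.zpowers ρ => g • q := fun g h hgh => by
    have : (h⁻¹ * g) • q = q := by
      rw [mul_smul]
      exact inv_smul_eq_iff.2 hgh
    exact (inv_mul_eq_one.1 (eq_one_of_smul_eq hρ _ q this)).symm
  rw [this, ← Set.image_univ, hinj.encard_image, Set.encard_univ, ENat.card_eq_coe_natCard,
    Nat.card_zpowers, hρ]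
  rfl

instance : IsProbabilityMeasure haarTernary := by
  unfold haarTernary
  infer_instance

lemma uniform_map_perm (σ : Equiv.Perm (Fin 3)) :
    (PMF.uniformOfFintype (Fin 3)).toMeasure.map σ = (PMF.uniformOfFintype (Fin 3)).toMeasure := by
  refine Measure.ext_of_singleton fun i => ?_
  have : σ ⁻¹' {i} = {σ.symm i} := by
    ext j
    simp [Equiv.eq_symm_apply]
  rw [Measure.map_apply (measurable_of_finite σ) (measurableSet_singleton i), this,
    PMF.toMeasure_apply_singleton _ _ (measurableSet_singleton _),
    PMF.toMeasure_apply_singleton _ _ (measurableSet_singleton _)]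
  simp

lemma measurePreserving_perm_smul (σ : Equiv.Perm (Fin 3)) :
    MeasurePreserving (fun x : ℕ → Fin 3 => σ • x) haarTernary haarTernary := by
  refine ⟨measurable_perm_smul σ, ?_⟩
  have := Measure.infinitePi_map_pi
    (μ := fun _ : ℕ => (PMF.uniformOfFintype (Fin 3)).toMeasure) (f := fun _ => σ)
    fun _ => measurable_of_finite σ
  simp only [uniform_map_perm] at this
  exact this

/-- Borel sets invariant under eventual equality satisfy the zero-one law. -/
lemma haarTernary_eq_zero_or_one {A : Set (ℕ → Fin 3)} (hA : MeasurableSet A)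
    (hinv : ∀ x y, E₀ x y → x ∈ A → y ∈ A) : haarTernary A = 0 ∨ haarTernary A = 1 := by
  have hind : iIndepFun (fun (n : ℕ) (x : ℕ → Fin 3) => x n) haarTernary :=
    iIndepFun_infinitePi (P := fun _ : ℕ => (PMF.uniformOfFintype (Fin 3)).toMeasure)
      (X := fun _ i => i) fun _ => measurable_id
  refine measure_zero_or_one_of_measurableSet_limsup_atTop
    (s := fun n => MeasurableSpace.comap (fun x : ℕ → Fin 3 => x n) inferInstance)
    (fun n => (measurable_pi_apply n).comap_le) hind ?_
  rw [limsup_eq_iInf_iSup_of_nat, MeasurableSpace.measurableSet_iInf]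
  intro n
  -- Overwriting the first `n` coordinates by `0` depends only on the later ones and stays in the
  -- `E₀`-class, so `A` equals its preimage under this map and is a tail event.
  have hmeas : Measurable[⨆ i ≥ n, MeasurableSpace.comap (fun x : ℕ → Fin 3 => x i) inferInstance]
      fun (x : ℕ → Fin 3) i => if i < n then 0 else x i := by
    refine @measurable_pi_lambda _ _ _ (_) _ _ fun i => ?_
    by_cases hi : i < n
    · simp only [hi, if_true]
      exact @measurable_const _ _ _ (_) _
    · simp only [hi, if_false]
      exact Measurable.mono (comap_measurable _)
        (le_iSup₂_of_le i (not_lt.1 hi) le_rfl) le_rfl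
  have hE (x : ℕ → Fin 3) : E₀ (fun i => if i < n then 0 else x i) x :=
    ⟨n, fun i hi => if_neg (not_lt.2 hi)⟩
  convert hmeas hA using 1
  ext x
  exact ⟨hinv _ _ (Setoid.symm' _ (hE x)), hinv _ _ (hE x)⟩

lemma measurableSet_eq_smul {f : Quotient E₀ → Quotient E₀} (hf : IsBorelFun f)
    (σ : Equiv.Perm (Fin 3)) :
    MeasurableSet {x : ℕ → Fin 3 | f (Quotient.mk E₀ x) = σ • Quotient.mk E₀ x} :=
  hf.preimage (measurable_id.prodMk (measurable_perm_smul σ))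

lemma ae_eq_self_of_involutive {ρ : Equiv.Perm (Fin 3)} (hρ : orderOf ρ = 3)
    {f : Quotient E₀ → Quotient E₀} (hf : IsBorelFun f) (hinv : Function.Involutive f)
    (hgr : GraphIn f (E₀OfMod (Subgroup.zpowers ρ))) : ∀ᵐ q ∂haarMod, f q = q := by
  have hmk : Measurable (Quotient.mk E₀) := measurable_quotient_mk''
  obtain ⟨g, hg⟩ : ∃ g : Subgroup.zpowers ρ,
      haarTernary {x | f (Quotient.mk E₀ x) = (g : Equiv.Perm (Fin 3)) • Quotient.mk E₀ x} ≠ 0 := by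
    by_contra! h
    have huniv : (⋃ g : Subgroup.zpowers ρ,
        {x | f (Quotient.mk E₀ x) = (g : Equiv.Perm (Fin 3)) • Quotient.mk E₀ x}) = Set.univ := by
      refine Set.eq_univ_of_forall fun x => Set.mem_iUnion.2 ?_
      have := hgr (Quotient.mk E₀ x)
      rw [E₀OfMod_eq_orbitRel] at this
      obtain ⟨g, hg⟩ := Setoid.symm' _ this
      exact ⟨g, hg.symm⟩
    have := measure_iUnion_null h
    rw [huniv, measure_univ] at this
    exact one_ne_zero this
  have hae : ∀ᵐ x ∂haarTernary,
      f (Quotient.mk E₀ x) = (g : Equiv.Perm (Fin 3)) • Quotient.mk E₀ x := by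
    refine (mem_ae_iff_prob_eq_one (measurableSet_eq_smul hf g)).2
      ((haarTernary_eq_zero_or_one (measurableSet_eq_smul hf g) ?_).resolve_left hg)
    intro x y hxy hx
    have : Quotient.mk E₀ x = Quotient.mk E₀ y := Quotient.sound hxy
    rwa [Set.mem_ofPred_eq, this] at hx
  obtain ⟨x, hx, hgx⟩ := (hae.and
    ((measurePreserving_perm_smul g).quasiMeasurePreserving.ae hae)).exists
  have hsq : g * g = 1 := by
    refine eq_one_of_smul_eq hρ _ (Quotient.mk E₀ x) ?_
    rw [mul_smul]
    exact (hgx.symm.trans (congrArg f hx.symm)).trans (hinv _)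
  have hg1 : g = 1 := by
    have h3 : g ^ 3 = 1 := Subtype.ext (pow_three_of_mem_zpowers hρ g.2)
    rwa [pow_succ, pow_two, hsq, one_mul] at h3
  -- Transfer to the quotient needs the fixed-point set to be measurable there, that is, to have a
  -- Borel preimage: the case `σ = 1`.
  refine (ae_map_iff hmk.aemeasurable ?_).2 ?_
  · have := measurableSet_eq_smul hf 1
    simp only [one_smul] at this
    exact measurableSet_quotient.2 this
  · filter_upwards [hae] with x hx
    rw [hx, hg1]
    exact one_smul _ _

/-- The partition into `{q}` and its complement is respected by every injective map fixing `q`, so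
its equivalence relation contains `generated S`. -/
lemma eq_of_generated_of_fixed {Q : Type*} {S : Set (Equiv.Perm Q)} {q r : Q}
    (hq : ∀ f ∈ S, f q = q) (h : generated S q r) : q = r := by
  let T : Setoid Q :=
    { r := fun a b => a = q ↔ b = q
      iseqv := ⟨fun _ => Iff.rfl, Iff.symm, Iff.trans⟩ }
  have hT : generated S ≤ T := sInf_le fun f hf a =>
    ⟨fun ha => by rw [ha, hq f hf], fun ha => f.injective (ha.trans (hq f hf).symm)⟩
  exact ((hT h).1 rfl).symm

lemma graphIn_generated {Q : Type*} {S : Set (Equiv.Perm Q)} {f : Equiv.Perm Q} (hf : f ∈ S) :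
    GraphIn f (generated S) :=
  fun q _ hF => hF f hf q

instance : IsProbabilityMeasure haarMod :=
  Measure.isProbabilityMeasure_map
    (measurable_quotient_mk'' : Measurable (Quotient.mk E₀)).aemeasurable

lemma generated_ne_E₀OfMod {ρ : Equiv.Perm (Fin 3)} (hρ : orderOf ρ = 3)
    {S : Set (Equiv.Perm (Quotient E₀))} (hS : S.Countable) (hinv : ∀ f ∈ S, IsBorelInvolution f) :
    generated S ≠ E₀OfMod (Subgroup.zpowers ρ) := by
  intro heq
  have hae : ∀ᵐ q ∂haarMod, ∀ f ∈ S, f q = q := (ae_ball_iff hS).2 fun f hf =>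
    ae_eq_self_of_involutive hρ (hinv f hf).1.1 (hinv f hf).2 (heq ▸ graphIn_generated hf)
  obtain ⟨q, hq⟩ := hae.exists
  have hsub : {r | E₀OfMod (Subgroup.zpowers ρ) q r} ⊆ {q} := fun r hr =>
    (eq_of_generated_of_fixed hq (heq ▸ hr)).symm
  have hcard := Set.encard_le_encard hsub
  rw [encard_orbit_eq_three hρ, Set.encard_singleton] at hcard
  exact absurd hcard (by decide)

end QuotientBorel

theorem mainTheorem6 (ρ : Equiv.Perm (Fin 3)) (hρ : orderOf ρ = 3) :
    -- the setting: two countable Borel equivalence relations, the induced action, index 3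
    QuotientBorel.IsCountableBorel QuotientBorel.E₀ ∧
    QuotientBorel.IsCountableBorel (QuotientBorel.E₀Of (Subgroup.zpowers ρ)) ∧
    QuotientBorel.IsBorelRel
      (fun a b : Quotient QuotientBorel.E₀ =>
        QuotientBorel.E₀OfMod (Subgroup.zpowers ρ) a b) ∧
    (∀ g : Subgroup.zpowers ρ, QuotientBorel.IsBorelAut
      (MulAction.toPerm g : Equiv.Perm (Quotient QuotientBorel.E₀))) ∧
    (∀ (g : Subgroup.zpowers ρ) (q : Quotient QuotientBorel.E₀), g • q = q → g = 1) ∧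
    QuotientBorel.E₀OfMod (Subgroup.zpowers ρ) =
      MulAction.orbitRel (Subgroup.zpowers ρ) (Quotient QuotientBorel.E₀) ∧
    (∀ q : Quotient QuotientBorel.E₀,
      {r | QuotientBorel.E₀OfMod (Subgroup.zpowers ρ) q r}.encard = 3) ∧
    -- every Borel involution contained in the relation is almost everywhere the identity
    (∀ f : Equiv.Perm (Quotient QuotientBorel.E₀), QuotientBorel.IsBorelInvolution f →
      QuotientBorel.GraphIn f (QuotientBorel.E₀OfMod (Subgroup.zpowers ρ)) →
      ∀ᵐ q ∂QuotientBorel.haarMod, f q = q) ∧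
    -- the relation is not generated by countably many Borel involutions
    (∀ S : Set (Equiv.Perm (Quotient QuotientBorel.E₀)), S.Countable →
      (∀ f ∈ S, QuotientBorel.IsBorelInvolution f) →
      QuotientBorel.generated S ≠ QuotientBorel.E₀OfMod (Subgroup.zpowers ρ)) := by
  exact ⟨⟨QuotientBorel.measurableSet_E₀, QuotientBorel.countable_E₀_class⟩,
    ⟨QuotientBorel.measurableSet_E₀Of _, QuotientBorel.countable_E₀Of_class _⟩,
    by simpa only [QuotientBorel.IsBorelRel, QuotientBorel.E₀OfMod_mk] using
      QuotientBorel.measurableSet_E₀Of (Subgroup.zpowers ρ),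
    fun g => ⟨QuotientBorel.isBorelFun_smul g, QuotientBorel.isBorelFun_smul g⁻¹⟩,
    QuotientBorel.eq_one_of_smul_eq hρ,
    QuotientBorel.E₀OfMod_eq_orbitRel _,
    QuotientBorel.encard_orbit_eq_three hρ,
    fun _ hf hgr => QuotientBorel.ae_eq_self_of_involutive hρ hf.1.1 hf.2 hgr,
    fun _ hS hinv => QuotientBorel.generated_ne_E₀OfMod hρ hS hinv⟩
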